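/- **Theorem 8 (Gronwall-type theorem, affine).** Let $d\ge n+2$. A $d$-web of hypersurfaces on a smooth $n$-manifold $M$ is a family of $d$ codimension-one foliations given by smooth 1-forms $\omega_1,\dots,\omega_d$ with $\omega_i\wedge d\omega_i=0$, any $n$ of which are linearly independent at every point. It is *geodesic* for a torsion-free affine connection $\nabla$ if all leaves of all its foliations are totally geodesic for $\nabla$. A *pointed* web is a web with a distinguished foliation $\{\omega_{i_0}=0\}$ which is locally given by functions, $df=s\,\omega_{i_0}$ with $s\neq 0$, these functions being determined up to affine gauge transformations $f\mapsto af+b$ ($a\ne0$, $b$ locally constant). A function $f$ is *affine* for $\nabla$ if the symmetric part $d^s_\nabla\,df$ of the covariant differential of $df$ vanishes. The *canonical affine structure* of a pointed geodesic $d$-web is the smooth torsion-free affine connection for which the web is geodesic and the functions giving the distinguished foliation are affine. Let $W$ and $W'$ be pointed geodesic $d$-webs of hypersurfaces on smooth $n$-manifolds $M$ and $M'$, with canonical affine structures $\nabla$ and $\nabla'$. Let $\varphi:M\to M'$ be a map of pointed webs: a smooth map which carries the foliations of $W$ to those of $W'$ (the foliations of $W$ are, up to a permutation of the indices, the pull-backs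 of those of $W'$), the distinguished foliation to the distinguished one, and the functions giving the distinguished foliations to each other up to affine gauge (locally $f'\circ\varphi=af+b$, $a\neq0$). Then $\varphi$ is affine with respect to $\nabla$ and $\nabla'$, i.e. $\nabla(\varphi^*\eta)=\varphi^*(\nabla'\eta)$ for every smooth 1-form $\eta$ on $M'$. -/

import Mathlib

open scoped Manifold ContDiff Topology
open Bundle

noncomputable section

namespace GeodesicWeb

/-- The model space of an `n`-dimensional manifold. -/
abbrev Model (n : ℕ) : Type := EuclideanSpace ℝ (Fin n)

section Forms

/-- A vector field (no regularity yet) on the `n`-manifold `M`. -/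
abbrev VField (n : ℕ) (M : Type*) [TopologicalSpace M] [ChartedSpace (Model n) M] :=
  (x : M) → TangentSpace 𝓘(ℝ, Model n) x

/-- A differential 1-form (no regularity yet) on the `n`-manifold `M`. -/
abbrev OneForm (n : ℕ) (M : Type*) [TopologicalSpace M] [ChartedSpace (Model n) M] :=
  (x : M) → (TangentSpace 𝓘(ℝ, Model n) x →L[ℝ] ℝ)

variable {n : ℕ} {M : Type*} [TopologicalSpace M] [ChartedSpace (Model n) M]

/-- The differential `df` of a real function, as a 1-form. -/
def differential (f : M → ℝ) : OneForm n M := fun x => mvfderiv 𝓘(ℝ, Model n) f x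

/-- The value of the exterior derivative `dη` on two vector fields:
`dη(X, Y) = X(η(Y)) - Y(η(X)) - η([X, Y])`. -/
def extDeriv (η : OneForm n M) (X Y : VField n M) (x : M) : ℝ :=
  differential (fun y => η y (Y y)) x (X x) - differential (fun y => η y (X y)) x (Y x)
    - η x (VectorField.mlieBracket 𝓘(ℝ, Model n) X Y x)

/-- The pull-back of a 1-form by a map. -/
def pullback {M' : Type*} [TopologicalSpace M'] [ChartedSpace (Model n) M']
    (φ : M → M') (η : OneForm n M') : OneForm n M :=
  fun x => (η (φ x)).comp (mfderiv 𝓘(ℝ, Model n) 𝓘(ℝ, Model n) φ x)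

variable [IsManifold 𝓘(ℝ, Model n) ∞ M]

/-- The vector field is of class `C^∞`. -/
def SmoothField (X : VField n M) : Prop :=
  ContMDiff 𝓘(ℝ, Model n) 𝓘(ℝ, Model n).tangent ∞
    (fun x => (TotalSpace.mk' (Model n) x (X x) : TangentBundle 𝓘(ℝ, Model n) M))

/-- The 1-form is of class `C^∞`, as a section of the cotangent bundle. -/
def SmoothForm (η : OneForm n M) : Prop :=
  ContMDiff 𝓘(ℝ, Model n) (𝓘(ℝ, Model n).prod 𝓘(ℝ, Model n →L[ℝ] ℝ)) ∞
    (fun x => TotalSpace.mk' (Model n →L[ℝ] ℝ)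
      (E := fun x : M => TangentSpace 𝓘(ℝ, Model n) x →L[ℝ] Trivial M ℝ x) x (η x))

/-- `η ∧ dη = 0`, the condition under which a nowhere vanishing 1-form `η` defines a foliation
of codimension one (with tangent spaces `ker η`). -/
def Integrable (η : OneForm n M) : Prop :=
  ∀ X Y Z : VField n M, SmoothField X → SmoothField Y → SmoothField Z → ∀ x,
    η x (X x) * extDeriv η Y Z x + η x (Y x) * extDeriv η Z X x
      + η x (Z x) * extDeriv η X Y x = 0

end Forms

section Connections

/-- A connection on the tangent bundle; `nabla Y x v` is `(∇_v Y)(x)`. -/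
abbrev Connection (n : ℕ) (M : Type*) [TopologicalSpace M] [ChartedSpace (Model n) M]
    [IsManifold 𝓘(ℝ, Model n) ∞ M] :=
  CovariantDerivative 𝓘(ℝ, Model n) (Model n) (TangentSpace 𝓘(ℝ, Model n) : M → Type _)

variable {n : ℕ} {M : Type*} [TopologicalSpace M] [ChartedSpace (Model n) M]
  [IsManifold 𝓘(ℝ, Model n) ∞ M]

/-- `nabla` is a smooth affine connection without torsion. -/
structure IsTorsionFreeConnection (nabla : Connection n M) : Prop where
  smooth : nabla.ContMDiffCovariantDerivative ∞
  torsion_eq_zero : nabla.torsion = 0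

/-- The covariant differential of a 1-form, for the dual connection on the cotangent bundle:
`(∇_X η)(Y) = X(η(Y)) - η(∇_X Y)`. -/
def covDiff (nabla : Connection n M) (η : OneForm n M) (X Y : VField n M) (x : M) : ℝ :=
  differential (fun y => η y (Y y)) x (X x) - η x (nabla Y x (X x))

/-- The symmetric part of the covariant differential of a 1-form. -/
def symCovDiff (nabla : Connection n M) (η : OneForm n M) (X Y : VField n M) (x : M) : ℝ :=
  (covDiff nabla η X Y x + covDiff nabla η Y X x) / 2

/-- The leaves of the foliation `ker η` are totally geodesic for `nabla`: covariant derivatives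
of vector fields tangent to the leaves along one another are tangent to the leaves. -/
def TotallyGeodesicLeaves (nabla : Connection n M) (η : OneForm n M) : Prop :=
  ∀ X Y : VField n M, SmoothField X → SmoothField Y →
    (∀ x, η x (X x) = 0) → (∀ x, η x (Y x) = 0) → ∀ x, η x (nabla Y x (X x)) = 0

/-- The function `f`, smooth on the open set `U`, is affine for `nabla` on `U`: the symmetric part
of the covariant differential of `df` vanishes. -/
def AffineFunctionOn (nabla : Connection n M) (f : M → ℝ) (U : Set M) : Prop :=
  ∀ X Y : VField n M, SmoothField X → SmoothField Y →
    ∀ x ∈ U, symCovDiff nabla (differential f) X Y x = 0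

/-- The smooth map `φ` is affine for the connections `nabla` and `nabla'`: pull-back of 1-forms
commutes with covariant differentiation, `∇(φ^* η) = φ^*(∇' η)` (equivalently, the second
fundamental form `∇dφ` vanishes). The right-hand side at `x` is evaluated with the help of
vector fields `X'`, `Y'` whose values at `φ x` are the images of those of `X`, `Y` at `x`. -/
def IsAffineMap {M' : Type*} [TopologicalSpace M'] [ChartedSpace (Model n) M']
    [IsManifold 𝓘(ℝ, Model n) ∞ M']
    (nabla : Connection n M) (nabla' : Connection n M') (φ : M → M') : Prop :=
  ∀ η : OneForm n M', SmoothForm η →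
  ∀ X Y : VField n M, SmoothField X → SmoothField Y →
  ∀ X' Y' : VField n M', SmoothField X' → SmoothField Y' →
  ∀ x : M,
    mfderiv 𝓘(ℝ, Model n) 𝓘(ℝ, Model n) φ x (X x) = X' (φ x) →
    mfderiv 𝓘(ℝ, Model n) 𝓘(ℝ, Model n) φ x (Y x) = Y' (φ x) →
    covDiff nabla (pullback φ η) X Y x = covDiff nabla' η X' Y' (φ x)

end Connections

section Webs

/-- A `d`-web of hypersurfaces (of codimension one) on the `n`-manifold `M`: `d` foliations given
by 1-forms, any `n` of which are linearly independent at every point. -/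
structure Web (n d : ℕ) (M : Type*) [TopologicalSpace M] [ChartedSpace (Model n) M]
    [IsManifold 𝓘(ℝ, Model n) ∞ M] where
  form : Fin d → OneForm n M
  smooth : ∀ i, SmoothForm (form i)
  integrable : ∀ i, Integrable (form i)
  independent : ∀ e : Fin n ↪ Fin d, ∀ x, LinearIndependent ℝ (fun k => form (e k) x)

/-- A pointed `d`-web: a `d`-web with a distinguished foliation, the latter being given locally by
functions that are determined up to affine gauge transformations `f ↦ a f + b`. Near the point `p`
the function `fn p`, on the open set `dom p`, is one of them. -/
structure PointedWeb (n d : ℕ) (M : Type*) [TopologicalSpace M] [ChartedSpace (Model n) M]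
    [IsManifold 𝓘(ℝ, Model n) ∞ M] extends Web n d M where
  /-- The index of the distinguished foliation. -/
  idx : Fin d
  dom : M → Set M
  fn : M → M → ℝ
  isOpen_dom : ∀ p, IsOpen (dom p)
  mem_dom : ∀ p, p ∈ dom p
  smooth_fn : ∀ p, ContMDiffOn 𝓘(ℝ, Model n) 𝓘(ℝ, ℝ) ∞ (fn p) (dom p)
  /-- The distinguished foliation is given by `fn p` on `dom p`. -/
  differential_fn : ∀ p, ∀ x ∈ dom p,
    ∃ s : ℝ, s ≠ 0 ∧ differential (fn p) x = s • form idx x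
  /-- Two of the functions differ locally by an affine gauge transformation. -/
  compatible : ∀ p q, ∀ x ∈ dom p ∩ dom q,
    ∃ a b : ℝ, a ≠ 0 ∧ ∀ᶠ y in 𝓝 x, fn q y = a * fn p y + b

variable {n d : ℕ} {M : Type*} [TopologicalSpace M] [ChartedSpace (Model n) M]
  [IsManifold 𝓘(ℝ, Model n) ∞ M]

/-- The web is geodesic for `nabla`: the leaves of all its foliations are totally geodesic. -/
def Web.IsGeodesic (W : Web n d M) (nabla : Connection n M) : Prop :=
  ∀ i, TotallyGeodesicLeaves nabla (W.form i)

/-- `nabla` is the canonical affine structure of the pointed geodesic web `W` (for `n + 2 ≤ d`):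
the torsion-free connection for which the web is geodesic and the functions that give the
distinguished foliation are affine. -/
structure PointedWeb.IsCanonical (W : PointedWeb n d M) (nabla : Connection n M) : Prop where
  torsionFree : IsTorsionFreeConnection nabla
  geodesic : W.toWeb.IsGeodesic nabla
  affine : ∀ p, AffineFunctionOn nabla (W.fn p) (W.dom p)

/-- A map of pointed webs: a smooth map (automatically a local diffeomorphism when
`n + 2 ≤ d`) that carries the foliations of `W` to those of `W'`, the distinguished foliation to
the distinguished one, and, locally and up to affine gauge transformations, the functions that
give the distinguished foliation to each other. -/
structure IsPointedWebMap {M' : Type*} [TopologicalSpace M'] [ChartedSpace (Model n) M']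
    [IsManifold 𝓘(ℝ, Model n) ∞ M']
    (W : PointedWeb n d M) (W' : PointedWeb n d M') (φ : M → M') : Prop where
  smooth : ContMDiff 𝓘(ℝ, Model n) 𝓘(ℝ, Model n) ∞ φ
  foliations : ∃ σ : Equiv.Perm (Fin d), σ W.idx = W'.idx ∧
    ∀ i x, ∃ s : ℝ, s ≠ 0 ∧ pullback φ (W'.form (σ i)) x = s • W.form i x
  functions : ∀ x, ∃ a b : ℝ, a ≠ 0 ∧ ∀ᶠ y in 𝓝 x, W'.fn (φ x) (φ y) = a * W.fn x y + b

end Webs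

end GeodesicWeb

end

/-!
Write `∇`, `∇'` for the two connections. A map `φ` of pointed webs pulls the forms of `W'` back to
nonzero multiples of forms of `W`, so its differential is invertible everywhere, and every smooth
vector field `X` on `M'` has a smooth pull-back `φ^*X` on `M`. The obstruction to `φ` being affine is
`B(X, Y) = dφ(∇_{φ^*X} φ^*Y) - ∇'_X Y` (`secondFundamentalForm`), which is tensorial, symmetric since
neither connection has torsion, and satisfies
`∇(φ^*η)(φ^*X, φ^*Y) - (∇'η)(X, Y) = -η(B(X, Y))` (`covDiff_pullback_sub_covDiff`).

At each point, `B` is thus a symmetric bilinear map on an `n`-dimensional space, and the webs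
constrain it by the `d ≥ n + 2` forms `ω'_i`, which are in general position:
* since both webs are geodesic, `B` preserves the kernel of every `ω'_i`
  (`form_secondFundamentalForm_eq_zero_of_tangent`);
* since the functions giving the distinguished foliations are affine and correspond to each other
  up to affine gauge, `ω'_{i₀} ∘ B = 0` (`form_idx_secondFundamentalForm_eq_zero`).

These conditions force `B = 0` (`bilinear_eq_zero_of_preserves_kernels`). Take as coordinates `n` of
the forms other than `ω'_{i₀}`, with dual basis `e_j`, and one more form `ω'_{i₁}`. For `j ≠ k` the
vector `B(e_j, e_k)` is killed by the `n - 2` coordinates other than the `j`-th and `k`-th, and by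
`ω'_{i₀}`; and `B(e_j, e_j)` is killed by `n - 1` coordinates and by `ω'_{i₀}`, hence is zero. Then the
vector `v` in the span of `e_j` and `e_k` with `ω'_{i₁}(v) = 0` gives `B(v, v)` as a nonzero multiple
of `B(e_j, e_k)`, so that `ω'_{i₁}` kills the latter as well, which makes `n` forms.
-/

namespace GeodesicWeb

/-! ### Quadratic maps that preserve hyperplanes in general position -/

/-- The pointwise form of the theorem. A family of at least `n + 2` linear forms on an
`n`-dimensional space is in general position when no nonzero vector is killed by `n` of them; a
symmetric bilinear map that preserves the kernel of each form vanishes as soon as one of the forms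
kills all its values. -/
theorem bilinear_eq_zero_of_preserves_kernels {ι V : Type*} [Fintype ι] [DecidableEq ι]
    [AddCommGroup V] [Module ℝ V] [FiniteDimensional ℝ V]
    (hcard : Module.finrank ℝ V + 2 ≤ Fintype.card ι) (ℓ : ι → V →ₗ[ℝ] ℝ)
    (general : ∀ s : Finset ι, s.card = Module.finrank ℝ V → ∀ v, (∀ i ∈ s, ℓ i v = 0) → v = 0)
    (B : V →ₗ[ℝ] V →ₗ[ℝ] V) (symm : ∀ v w, B v w = B w v)
    (preserves : ∀ i v w, ℓ i v = 0 → ℓ i w = 0 → ℓ i (B v w) = 0)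
    (i₀ : ι) (hi₀ : ∀ v w, ℓ i₀ (B v w) = 0) : B = 0 := by
  classical
  -- Two forms `i₀`, `i₁` are set aside; `n` of the others serve as coordinates.
  obtain ⟨T, hT, hTcard⟩ := Finset.exists_subset_card_eq
    (s := Finset.univ.erase i₀) (n := Module.finrank ℝ V + 1)
    (by rw [Finset.card_erase_of_mem (Finset.mem_univ _), Finset.card_univ]; omega)
  obtain ⟨i₁, hi₁⟩ : T.Nonempty := Finset.card_pos.1 (by omega)
  set S := T.erase i₁ with hS
  have hScard : S.card = Module.finrank ℝ V := by
    rw [hS, Finset.card_erase_of_mem hi₁, hTcard]; omega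
  have hi₀T : i₀ ∉ T := fun h => by simpa using hT h
  have hi₀S : i₀ ∉ S := fun h => hi₀T (Finset.mem_of_mem_erase h)
  have hi₁S : i₁ ∉ S := by simp [hS]
  have hne : i₀ ≠ i₁ := fun h => hi₀T (h ▸ hi₁)
  let L : V →ₗ[ℝ] (S → ℝ) := LinearMap.pi fun i => ℓ i
  have hL : Function.Injective L := by
    refine (injective_iff_map_eq_zero L).2 fun v hv => general S hScard v fun i hi => ?_
    exact congrFun hv ⟨i, hi⟩
  let b : Module.Basis S ℝ V := Module.Basis.ofEquivFun
    (LinearMap.linearEquivOfInjective L hL (by simp [hScard]))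
  have hb : ∀ i j : S, ℓ i (b j) = if i = j then 1 else 0 := fun i j => by
    have h := b.equivFun_self j i
    have h' : b.equivFun (b j) i = ℓ i (b j) := by
      simp only [b, Module.Basis.equivFun_ofEquivFun]
      rfl
    rw [← h', h]
    simp only [eq_comm]
  -- A form outside the coordinates vanishes on no basis vector: `n` forms would kill that vector.
  have hb_ne : ∀ i : S, ∀ a, a ∉ S → ℓ a (b i) ≠ 0 := fun i a ha h => by
    refine b.ne_zero i (general (insert a (S.erase i)) ?_ _ fun j hj => ?_)
    · have := Finset.card_pos.2 ⟨_, i.2⟩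
      rw [Finset.card_insert_of_notMem (by simp [ha]), Finset.card_erase_of_mem i.2]
      omega
    · rcases Finset.mem_insert.1 hj with rfl | hj
      · exact h
      · have hj' := Finset.mem_erase.1 hj
        rw [hb ⟨j, hj'.2⟩ i, if_neg]
        exact fun h => hj'.1 (congrArg Subtype.val h)
  have hB : ∀ i j k : S, i ≠ j → i ≠ k → ℓ i (B (b j) (b k)) = 0 := fun i j k hj hk =>
    preserves _ _ _ (by rw [hb, if_neg hj]) (by rw [hb, if_neg hk])
  have hdiag : ∀ j : S, B (b j) (b j) = 0 := fun j => by
    refine general (insert i₀ (S.erase j)) ?_ _ fun i hi => ?_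
    · have := Finset.card_pos.2 ⟨_, j.2⟩
      rw [Finset.card_insert_of_notMem (by simp [hi₀S]), Finset.card_erase_of_mem j.2]
      omega
    · rcases Finset.mem_insert.1 hi with rfl | hi
      · exact hi₀ _ _
      · have hi' := Finset.mem_erase.1 hi
        have h : (⟨i, hi'.2⟩ : S) ≠ j := fun h => hi'.1 (congrArg Subtype.val h)
        exact hB ⟨i, hi'.2⟩ j j h h
  refine b.ext fun j => b.ext fun k => ?_
  rw [LinearMap.zero_apply, LinearMap.zero_apply]
  rcases eq_or_ne j k with rfl | hjk
  · exact hdiag j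
  have hjk' : (k : ι) ≠ j := fun h => hjk (Subtype.ext h.symm)
  -- Polarization of `ℓ i₁ (B v v) = 0` at the vector `v` of `span {b j, b k}` killed by `ℓ i₁`.
  have h₁ : ℓ i₁ (B (b j) (b k)) = 0 := by
    set p := ℓ i₁ (b k) with hp
    set q := ℓ i₁ (b j) with hq
    have hv : ℓ i₁ (p • b j - q • b k) = 0 := by
      simp only [map_sub, map_smul, smul_eq_mul, ← hp, ← hq]
      ring
    have h := preserves i₁ _ _ hv hv
    simp only [map_sub, map_smul, LinearMap.sub_apply, LinearMap.smul_apply, hdiag,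
      symm (b k) (b j), smul_eq_mul, map_zero] at h
    have hpq : p * q ≠ 0 := mul_ne_zero (hb_ne k i₁ hi₁S) (hb_ne j i₁ hi₁S)
    refine (mul_eq_zero.1 (?_ : p * q * _ = 0)).resolve_left hpq
    linarith
  refine general (insert i₀ (insert i₁ ((S.erase j).erase k))) ?_ _ fun i hi => ?_
  · have hk : (k : ι) ∈ S.erase j := Finset.mem_erase.2 ⟨hjk', k.2⟩
    have := Finset.card_pos.2 ⟨_, hk⟩
    have h2 := Finset.card_erase_of_mem j.2
    rw [Finset.card_insert_of_notMem (by simp [hi₀S, hne]),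
      Finset.card_insert_of_notMem (by simp [hi₁S]), Finset.card_erase_of_mem hk]
    omega
  · rcases Finset.mem_insert.1 hi with rfl | hi
    · exact hi₀ _ _
    rcases Finset.mem_insert.1 hi with rfl | hi
    · exact h₁
    · have hik := Finset.mem_erase.1 hi
      have hij := Finset.mem_erase.1 hik.2
      exact hB ⟨i, hij.2⟩ j k (fun h => hij.1 (congrArg Subtype.val h))
        (fun h => hik.1 (congrArg Subtype.val h))

/-! ### Smooth vector fields and covariant differentials of 1-forms -/

section Fields

variable {n : ℕ} {M : Type*} [TopologicalSpace M] [ChartedSpace (Model n) M]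
  [IsManifold 𝓘(ℝ, Model n) ∞ M]

/-- The vector field is differentiable at the point `x`. -/
abbrev DifferentiableFieldAt (X : VField n M) (x : M) : Prop :=
  MDifferentiableAt 𝓘(ℝ, Model n) 𝓘(ℝ, Model n).tangent
    (fun y => (TotalSpace.mk' (Model n) y (X y) : TangentBundle 𝓘(ℝ, Model n) M)) x

theorem SmoothField.mdifferentiableAt {X : VField n M} (hX : SmoothField X) (x : M) :
    DifferentiableFieldAt X x :=
  ContMDiffAt.mdifferentiableAt (hX x) (by simp)

/-- Every tangent vector is the value of a smooth vector field. -/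
theorem exists_smoothField_eq [T2Space M] (x : M) (v : TangentSpace 𝓘(ℝ, Model n) x) :
    ∃ X : VField n M, SmoothField X ∧ X x = v := by
  let t := trivializationAt (Model n) (TangentSpace 𝓘(ℝ, Model n) : M → Type _) x
  have hx : x ∈ t.baseSet := FiberBundle.mem_baseSet_trivializationAt' x
  let b := Module.Basis.ofVectorSpace ℝ (Model n)
  obtain ⟨f, hf, -⟩ := (SmoothBumpFunction.nhds_basis_support (I := 𝓘(ℝ, Model n))
    (t.open_baseSet.mem_nhds hx)).mem_iff.1 (t.open_baseSet.mem_nhds hx)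
  have hs := fun i => t.contMDiffOn_localFrame_baseSet (I := 𝓘(ℝ, Model n)) ∞ b i
  let X : VField n M := fun y => ∑ i, (t.basisAt b hx).repr v i • (f y • t.localFrame b i y)
  refine ⟨X, ?_, ?_⟩
  · refine ContMDiff.sum_section fun i _ => ContMDiff.const_smul_section ?_
    exact ContMDiffOn.smul_section_of_tsupport f.contMDiff.contMDiffOn t.open_baseSet hf (hs i)
  · have h1 : ∀ i, t.localFrame b i x = t.basisAt b hx i := fun i => by
      simp [hx, Trivialization.basisAt]
    simp only [X, f.eq_one, one_smul, h1]
    exact (t.basisAt b hx).sum_repr v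

theorem SmoothForm.contMDiff_apply {η : OneForm n M} (hη : SmoothForm η) {X : VField n M}
    (hX : SmoothField X) : 
    ContMDiff 𝓘(ℝ, Model n) 𝓘(ℝ) ∞ (fun y => η y (X y)) := by
  intro x
  have h := ContMDiffAt.clm_bundle_apply (F₁ := Model n) (F₂ := ℝ)
    (E₁ := (TangentSpace 𝓘(ℝ, Model n) : M → Type _)) (E₂ := Trivial M ℝ)
    (b := fun m : M => m) (ϕ := η) (hη x) (hX x)
  exact (contMDiffAt_totalSpace.1 h).2

/-- A vector killed by the 1-form `η` at a point where `η ≠ 0` is the value of a smooth vector field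
that `η` kills on the whole manifold. -/
theorem exists_smoothField_eq_of_apply_eq_zero [T2Space M] {η : OneForm n M}
    (hη : SmoothForm η) {x : M} (hx : η x ≠ 0) {v : TangentSpace 𝓘(ℝ, Model n) x}
    (hv : η x v = 0) :
    ∃ X : VField n M, SmoothField X ∧ (∀ y, η y (X y) = 0) ∧ X x = v := by
  obtain ⟨w, hw⟩ : ∃ w, η x w ≠ 0 := by
    by_contra! h
    exact hx (ContinuousLinearMap.ext h)
  obtain ⟨X, hX, rfl⟩ := exists_smoothField_eq x v
  obtain ⟨Z, hZ, hZx⟩ := exists_smoothField_eq x ((η x w)⁻¹ • w)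
  have hZ1 : η x (Z x) = 1 := by rw [hZx, map_smul, smul_eq_mul, inv_mul_cancel₀ hw]
  -- `η(Z) X - η(X) Z` lies in the kernel of `η` everywhere, even where `η` vanishes.
  refine ⟨(fun y => η y (Z y)) • X - (fun y => η y (X y)) • Z, ?_, fun y => ?_, ?_⟩
  · exact ((hη.contMDiff_apply hZ).smul_section hX).sub_section
      ((hη.contMDiff_apply hX).smul_section hZ)
  · simp only [Pi.sub_apply, Pi.smul_apply', map_sub, map_smul, smul_eq_mul]
    ring
  · simp [hZ1, hv]

/-- The covariant differential of a 1-form is tensorial in its second vector field. -/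
theorem covDiff_congr (nabla : Connection n M) {θ : OneForm n M} {x : M}
    (hθ : ∀ Y : VField n M, DifferentiableFieldAt Y x →
      MDifferentiableAt 𝓘(ℝ, Model n) 𝓘(ℝ) (fun y => θ y (Y y)) x)
    {X X' Y Y' : VField n M} (hY : DifferentiableFieldAt Y x)
    (hY' : DifferentiableFieldAt Y' x)
    (hX : X x = X' x) (h : Y x = Y' x) :
    covDiff nabla θ X Y x = covDiff nabla θ X' Y' x := by
  have ht : TensorialAt 𝓘(ℝ, Model n) (Model n) (fun Y => covDiff nabla θ X' Y x) x :=
    { smul := fun {f σ} hf hσ => by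
        have h1 : (fun y => θ y ((f • σ) y)) = fun y => f y * θ y (σ y) := by
          funext y; simp
        simp only [covDiff, differential]
        rw [h1, nabla.isCovariantDerivativeOn.leibniz hσ hf]
        rw [show (fun y => f y * θ y (σ y)) = f * (fun y => θ y (σ y)) from rfl,
          mvfderiv_mul hf (hθ σ hσ)]
        simp
        ring
      add := fun {σ σ'} hσ hσ' => by
        have h1 : (fun y => θ y ((σ + σ') y)) = (fun y => θ y (σ y)) + fun y => θ y (σ' y) := by
          funext y; simp
        simp only [covDiff, differential]
        rw [h1, nabla.isCovariantDerivativeOn.add hσ hσ', mvfderiv_add (hθ σ hσ) (hθ σ' hσ')]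
        simp
        ring }
  have h2 : covDiff nabla θ X Y x = covDiff nabla θ X' Y x := by simp only [covDiff, hX]
  exact h2.trans (ht.pointwise hY hY' h)

end Fields

/-! ### Web forms in general position and the second fundamental form of a map -/

section GeneralPosition

/-- As many independent forms as the dimension have no common nonzero zero. -/
theorem eq_zero_of_linearIndependent_apply_eq_zero {ι V : Type*} [Fintype ι]
    [NormedAddCommGroup V] [NormedSpace ℝ V] [FiniteDimensional ℝ V] {f : ι → V →L[ℝ] ℝ}
    (hf : LinearIndependent ℝ f) (hcard : Fintype.card ι = Module.finrank ℝ V) {v : V}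
    (hv : ∀ i, f i v = 0) : v = 0 := by
  let L : (V →L[ℝ] ℝ) →ₗ[ℝ] Module.Dual ℝ V := ContinuousLinearMap.coeLM ℝ
  have hL : LinearIndependent ℝ (L ∘ f) :=
    hf.map' L (LinearMap.ker_eq_bot.2 ContinuousLinearMap.coe_injective)
  have hspan := hL.span_eq_top_of_card_eq_finrank' (by rw [hcard, Subspace.dual_finrank_eq])
  refine (Module.forall_dual_apply_eq_zero_iff ℝ v).1 fun g => ?_
  have hg : g ∈ Submodule.span ℝ (Set.range (L ∘ f)) := hspan ▸ Submodule.mem_top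
  induction hg using Submodule.span_induction with
  | mem g hg =>
    obtain ⟨i, rfl⟩ := hg
    exact hv i
  | zero => rfl
  | add g g' _ _ h h' => rw [LinearMap.add_apply, h, h', add_zero]
  | smul c g _ h => rw [LinearMap.smul_apply, h, smul_zero]

variable {n d : ℕ} {M : Type*} [TopologicalSpace M] [ChartedSpace (Model n) M]
  [IsManifold 𝓘(ℝ, Model n) ∞ M]

theorem Web.eq_zero_of_form_eq_zero (W : Web n d M) {s : Finset (Fin d)} (hs : s.card = n)
    {x : M} {v : TangentSpace 𝓘(ℝ, Model n) x} (hv : ∀ i ∈ s, W.form i x v = 0) : v = 0 :=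
  eq_zero_of_linearIndependent_apply_eq_zero (V := Model n)
    (W.independent (s.orderEmbOfFin hs).toEmbedding x) (by simp)
    fun k => hv _ (s.orderEmbOfFin_mem hs k)

theorem Web.form_ne_zero (W : Web n d M) (hn : 0 < n) (hd : n ≤ d) (i : Fin d) (x : M) :
    W.form i x ≠ 0 := by
  obtain ⟨s, his, -, hs⟩ := Finset.exists_subsuperset_card_eq (s := {i}) (t := Finset.univ) (n := n)
    (Finset.subset_univ _) (by simpa using Nat.succ_le_of_lt hn) (by simpa using hd)
  have hi : i ∈ Set.range (s.orderEmbOfFin hs) := by simpa using his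
  obtain ⟨k, rfl⟩ := hi
  exact (W.independent (s.orderEmbOfFin hs).toEmbedding x).ne_zero k

end GeneralPosition

section Maps

variable {n : ℕ} {M : Type*} [TopologicalSpace M] [ChartedSpace (Model n) M]
  [IsManifold 𝓘(ℝ, Model n) ∞ M]
  {M' : Type*} [TopologicalSpace M'] [ChartedSpace (Model n) M']
  [IsManifold 𝓘(ℝ, Model n) ∞ M']
  {φ : M → M'}

/-- The differential of a map of webs is injective, because a vector in its kernel is killed by all
forms of the source web. -/
theorem IsPointedWebMap.isInvertible_mfderiv {d : ℕ} (hd : n ≤ d) {W : PointedWeb n d M}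
    {W' : PointedWeb n d M'} (hφ : IsPointedWebMap W W' φ) (x : M) :
    (mfderiv 𝓘(ℝ, Model n) 𝓘(ℝ, Model n) φ x).IsInvertible := by
  obtain ⟨σ, -, hσ⟩ := hφ.foliations
  obtain ⟨s, -, hs⟩ := Finset.exists_subset_card_eq (s := (Finset.univ : Finset (Fin d))) (n := n)
    (by simpa using hd)
  let D : Model n →L[ℝ] Model n := mfderiv 𝓘(ℝ, Model n) 𝓘(ℝ, Model n) φ x
  have hinj : Function.Injective D := by
    refine (injective_iff_map_eq_zero D).2 fun v hv =>
      W.eq_zero_of_form_eq_zero (x := x) hs fun i _ => ?_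
    obtain ⟨c, hc, h⟩ := hσ i x
    have h1 : W'.form (σ i) (φ x) (D v) = c * W.form i x v := congrArg (fun η => η v) h
    have h2 : W'.form (σ i) (φ x) (D v) = 0 := by
      rw [hv]
      exact map_zero (W'.form (σ i) (φ x))
    exact (mul_eq_zero.1 (h1.symm.trans h2)).resolve_left hc
  exact ⟨(LinearEquiv.ofInjectiveEndo (D : Model n →ₗ[ℝ] Model n) hinj).toContinuousLinearEquiv,
    by ext v; rfl⟩

omit [IsManifold 𝓘(ℝ, Model n) ∞ M] [IsManifold 𝓘(ℝ, Model n) ∞ M'] in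
theorem mfderiv_mpullback {x : M}
    (hx : (mfderiv 𝓘(ℝ, Model n) 𝓘(ℝ, Model n) φ x).IsInvertible) (X : VField n M') :
    mfderiv 𝓘(ℝ, Model n) 𝓘(ℝ, Model n) φ x
      (VectorField.mpullback 𝓘(ℝ, Model n) 𝓘(ℝ, Model n) φ X x) = X (φ x) := by
  rw [VectorField.mpullback_apply]
  exact hx.self_apply_inverse _

theorem SmoothField.mpullback (hφ : ContMDiff 𝓘(ℝ, Model n) 𝓘(ℝ, Model n) ∞ φ)
    (hinv : ∀ x, (mfderiv 𝓘(ℝ, Model n) 𝓘(ℝ, Model n) φ x).IsInvertible)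
    {X : VField n M'} (hX : SmoothField X) :
    SmoothField (VectorField.mpullback 𝓘(ℝ, Model n) 𝓘(ℝ, Model n) φ X) :=
  ContMDiff.mpullback_vectorField hX hφ hinv (by simp)

theorem SmoothForm.mdifferentiableAt_pullback_apply {η : OneForm n M'} (hη : SmoothForm η)
    (hφ : ContMDiff 𝓘(ℝ, Model n) 𝓘(ℝ, Model n) ∞ φ) {x : M} {Y : VField n M}
    (hY : DifferentiableFieldAt Y x) :
    MDifferentiableAt 𝓘(ℝ, Model n) 𝓘(ℝ) (fun y => pullback φ η y (Y y)) x := by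
  have h1 := ((hη.mdifferentiable (by simp)) (φ x)).comp x (hφ.mdifferentiable (by simp) x)
  have h2 := ((hφ.contMDiff_tangentMap (m := ∞) (by simp)).mdifferentiable
    (by simp) _).comp x hY
  have h := MDifferentiableAt.clm_bundle_apply (F₁ := Model n) (F₂ := ℝ)
    (E₁ := (TangentSpace 𝓘(ℝ, Model n) : M' → Type _)) (E₂ := Trivial M' ℝ)
    (b := φ) (ϕ := fun m => η (φ m))
    (v := fun m => mfderiv 𝓘(ℝ, Model n) 𝓘(ℝ, Model n) φ m (Y m)) h1 h2
  exact ((mdifferentiableAt_totalSpace _ _).1 h).2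

/-- The second fundamental form `∇dφ` (up to sign) of `φ` at the point `x`, evaluated on vector
fields of the target with the help of their pull-backs by `φ`:
`dφ(∇_{φ^*X} φ^*Y) - ∇'_X Y`. It is meaningful only where the differential of `φ` is invertible, as
pull-backs of vector fields are zero elsewhere. -/
noncomputable def secondFundamentalForm (nabla : Connection n M) (nabla' : Connection n M')
    (φ : M → M') (x : M) (X Y : VField n M') : TangentSpace 𝓘(ℝ, Model n) (φ x) :=
  mfderiv 𝓘(ℝ, Model n) 𝓘(ℝ, Model n) φ x
      (nabla (VectorField.mpullback 𝓘(ℝ, Model n) 𝓘(ℝ, Model n) φ Y) x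
        (VectorField.mpullback 𝓘(ℝ, Model n) 𝓘(ℝ, Model n) φ X x))
    - nabla' Y (φ x) (X (φ x))

/-- The second fundamental form is tensorial: the derivatives of the coefficients of `Y` that
the Leibniz rules for the two connections produce cancel. -/
theorem exists_bilinear_eq_secondFundamentalForm (nabla : Connection n M)
    (nabla' : Connection n M') (hφ : ContMDiff 𝓘(ℝ, Model n) 𝓘(ℝ, Model n) ∞ φ)
    (hinv : ∀ x, (mfderiv 𝓘(ℝ, Model n) 𝓘(ℝ, Model n) φ x).IsInvertible) (x : M) :
    ∃ B : TangentSpace 𝓘(ℝ, Model n) (φ x) →L[ℝ] TangentSpace 𝓘(ℝ, Model n) (φ x) →L[ℝ]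
        TangentSpace 𝓘(ℝ, Model n) (φ x),
      ∀ X Y : VField n M', SmoothField X → SmoothField Y →
        B (X (φ x)) (Y (φ x)) = secondFundamentalForm nabla nabla' φ x X Y := by
  have hpull : ∀ Y : VField n M', DifferentiableFieldAt Y (φ x) →
      DifferentiableFieldAt (VectorField.mpullback 𝓘(ℝ, Model n) 𝓘(ℝ, Model n) φ Y) x :=
    fun Y hY => MDifferentiableAt.mpullback_vectorField hY (hφ x) (hinv x)
      ENat.LEInfty.out
  have h₁ : ∀ Y : VField n M', DifferentiableFieldAt Y (φ x) →
      TensorialAt 𝓘(ℝ, Model n) (Model n)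
        (fun X => secondFundamentalForm nabla nabla' φ x X Y) (φ x) := fun Y _ =>
    { smul := fun {f σ} _ _ => by
        simp only [secondFundamentalForm, VectorField.mpullback_smul_apply, Pi.smul_apply',
          map_smul, smul_sub]
      add := fun {σ σ'} _ _ => by
        simp only [secondFundamentalForm, VectorField.mpullback_add_apply, Pi.add_apply, map_add]
        abel }
  have h₂ : ∀ X : VField n M', DifferentiableFieldAt X (φ x) →
      TensorialAt 𝓘(ℝ, Model n) (Model n)
        (fun Y => secondFundamentalForm nabla nabla' φ x X Y) (φ x) := fun X _ =>
    { smul := fun {f σ} hf hσ => by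
        have hf' : MDifferentiableAt 𝓘(ℝ, Model n) 𝓘(ℝ) (f ∘ φ) x :=
          hf.comp x (hφ.mdifferentiable (by simp) x)
        simp only [secondFundamentalForm, VectorField.mpullback_smul]
        rw [nabla.isCovariantDerivativeOn.leibniz (hpull σ hσ) hf',
          nabla'.isCovariantDerivativeOn.leibniz hσ hf,
          mvfderiv_comp x hf (hφ.mdifferentiable (by simp) x)]
        simp only [_root_.add_apply, _root_.smul_apply,
          ContinuousLinearMap.smulRight_apply, ContinuousLinearMap.comp_apply, map_add, map_smul,
          mfderiv_mpullback (hinv x), Function.comp_apply, smul_sub]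
        abel
      add := fun {σ σ'} hσ hσ' => by
        simp only [secondFundamentalForm, VectorField.mpullback_add]
        rw [nabla.isCovariantDerivativeOn.add (hpull σ hσ) (hpull σ' hσ'),
          nabla'.isCovariantDerivativeOn.add hσ hσ']
        simp only [_root_.add_apply, map_add]
        abel }
  exact ⟨TensorialAt.mkHom₂ _ (φ x) h₁ h₂, fun X Y hX hY =>
    TensorialAt.mkHom₂_apply h₁ h₂ (hX.mdifferentiableAt _) (hY.mdifferentiableAt _)⟩

theorem secondFundamentalForm_symm {nabla : Connection n M} {nabla' : Connection n M'}
    (h : IsTorsionFreeConnection nabla) (h' : IsTorsionFreeConnection nabla')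
    (hφ : ContMDiff 𝓘(ℝ, Model n) 𝓘(ℝ, Model n) ∞ φ)
    (hinv : ∀ x, (mfderiv 𝓘(ℝ, Model n) 𝓘(ℝ, Model n) φ x).IsInvertible) (x : M)
    {X Y : VField n M'} (hX : SmoothField X) (hY : SmoothField Y) :
    secondFundamentalForm nabla nabla' φ x X Y = secondFundamentalForm nabla nabla' φ x Y X := by
  have hM : IsManifold 𝓘(ℝ, Model n) (minSmoothness ℝ 2) M := by
    rw [minSmoothness_of_isRCLikeNormedField]; infer_instance
  have hM' : IsManifold 𝓘(ℝ, Model n) (minSmoothness ℝ 2) M' := by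
    rw [minSmoothness_of_isRCLikeNormedField]; infer_instance
  have h1 := (nabla.torsion_eq_zero_iff.1 h.torsion_eq_zero)
    ((hX.mpullback hφ hinv).mdifferentiableAt x) ((hY.mpullback hφ hinv).mdifferentiableAt x)
  have h2 := (nabla'.torsion_eq_zero_iff.1 h'.torsion_eq_zero)
    (hX.mdifferentiableAt (φ x)) (hY.mdifferentiableAt (φ x))
  rw [← VectorField.mpullback_mlieBracket (hX.mdifferentiableAt _) (hY.mdifferentiableAt _) (hφ x)
    (by rw [minSmoothness_of_isRCLikeNormedField]; exact ENat.LEInfty.out)] at h1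
  have h3 := congrArg (mfderiv 𝓘(ℝ, Model n) 𝓘(ℝ, Model n) φ x) h1
  rw [mfderiv_mpullback (hinv x), ← h2, map_sub] at h3
  simp only [secondFundamentalForm]
  rw [sub_eq_sub_iff_sub_eq_sub]
  exact h3

/-- The second fundamental form measures the failure of `φ` to be affine. -/
theorem covDiff_pullback_sub_covDiff (nabla : Connection n M) (nabla' : Connection n M')
    (hφ : ContMDiff 𝓘(ℝ, Model n) 𝓘(ℝ, Model n) ∞ φ)
    (hinv : ∀ x, (mfderiv 𝓘(ℝ, Model n) 𝓘(ℝ, Model n) φ x).IsInvertible) {x : M}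
    {η : OneForm n M'} {X Y : VField n M'}
    (hηY : MDifferentiableAt 𝓘(ℝ, Model n) 𝓘(ℝ) (fun y => η y (Y y)) (φ x)) :
    covDiff nabla (pullback φ η) (VectorField.mpullback 𝓘(ℝ, Model n) 𝓘(ℝ, Model n) φ X)
        (VectorField.mpullback 𝓘(ℝ, Model n) 𝓘(ℝ, Model n) φ Y) x
      - covDiff nabla' η X Y (φ x) = -η (φ x) (secondFundamentalForm nabla nabla' φ x X Y) := by
  have h1 : (fun y => pullback φ η y (VectorField.mpullback 𝓘(ℝ, Model n) 𝓘(ℝ, Model n) φ Y y))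
      = (fun z => η z (Y z)) ∘ φ := by
    funext y
    simp only [pullback, ContinuousLinearMap.comp_apply, mfderiv_mpullback (hinv y),
      Function.comp_apply]
  simp only [covDiff, differential, secondFundamentalForm, h1]
  rw [mvfderiv_comp_apply x hηY (hφ.mdifferentiable (by simp) x), mfderiv_mpullback (hinv x),
    map_sub]
  simp only [pullback, ContinuousLinearMap.comp_apply]
  ring

end Maps

/-! ### Maps of pointed geodesic webs -/

section WebMaps

theorem differential_congr {n : ℕ} {M : Type*} [TopologicalSpace M] [ChartedSpace (Model n) M]
    {f g : M → ℝ} {x : M} (h : f =ᶠ[𝓝 x] g) :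
    differential (n := n) f x = differential (n := n) g x :=
  h.mfderiv_eq

variable {n d : ℕ} {M : Type*} [TopologicalSpace M] [ChartedSpace (Model n) M]
  [IsManifold 𝓘(ℝ, Model n) ∞ M]
  {M' : Type*} [TopologicalSpace M'] [ChartedSpace (Model n) M']
  [IsManifold 𝓘(ℝ, Model n) ∞ M']
  {nabla : Connection n M} {nabla' : Connection n M'} {φ : M → M'}

/-- For `f` smooth on the open set `U`, the function `df(Y)` is the fibre coordinate of the tangent map
of `f` composed with `Y`. -/
theorem mdifferentiableAt_differential_apply {f : M → ℝ} {U : Set M} (hU : IsOpen U)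
    (hf : ContMDiffOn 𝓘(ℝ, Model n) 𝓘(ℝ, ℝ) ∞ f U) {x : M} (hx : x ∈ U) {Y : VField n M}
    (hY : SmoothField Y) :
    MDifferentiableAt 𝓘(ℝ, Model n) 𝓘(ℝ) (fun y => differential f y (Y y)) x := by
  have h1 : ContMDiffOn 𝓘(ℝ, Model n).tangent 𝓘(ℝ, ℝ).tangent ∞
      (tangentMapWithin 𝓘(ℝ, Model n) 𝓘(ℝ, ℝ) f U)
      (TotalSpace.proj ⁻¹' U : Set (TangentBundle 𝓘(ℝ, Model n) M)) :=
    hf.contMDiffOn_tangentMapWithin (by simp) hU.uniqueMDiffOn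
  have h2 : ContMDiffOn 𝓘(ℝ, Model n) 𝓘(ℝ) ∞
      (fun y => (tangentMapWithin 𝓘(ℝ, Model n) 𝓘(ℝ, ℝ) f U ⟨y, Y y⟩).2) U :=
    (contMDiff_snd_tangentBundle_modelSpace ℝ 𝓘(ℝ, ℝ)).comp_contMDiffOn
      (h1.comp hY.contMDiffOn fun y hy => hy)
  -- On the open set `U`, the derivative within `U` is the derivative.
  refine ((h2.contMDiffAt (hU.mem_nhds hx)).mdifferentiableAt (by simp)).congr_of_eventuallyEq ?_
  filter_upwards [hU.mem_nhds hx] with y hy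
  change mfderiv 𝓘(ℝ, Model n) 𝓘(ℝ, ℝ) f y (Y y)
    = mfderivWithin 𝓘(ℝ, Model n) 𝓘(ℝ, ℝ) f U y (Y y)
  rw [mfderivWithin_of_isOpen hU hy]

/-- Pull-backs of fields tangent to a foliation of the target web are tangent to the corresponding
foliation of the source web, so both terms of the second fundamental form are tangent to the
foliation of the target. -/
theorem form_secondFundamentalForm_eq_zero_of_tangent [T2Space M'] {W : PointedWeb n d M}
    {W' : PointedWeb n d M'} (hg : W.toWeb.IsGeodesic nabla) (hg' : W'.toWeb.IsGeodesic nabla')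
    (hφ : IsPointedWebMap W W' φ)
    (hinv : ∀ x, (mfderiv 𝓘(ℝ, Model n) 𝓘(ℝ, Model n) φ x).IsInvertible)
    {X Y : VField n M'} (hX : SmoothField X) (hY : SmoothField Y) (j : Fin d)
    (hjX : ∀ y, W'.form j y (X y) = 0) (hjY : ∀ y, W'.form j y (Y y) = 0) (x : M) :
    W'.form j (φ x) (secondFundamentalForm nabla nabla' φ x X Y) = 0 := by
  obtain ⟨σ, -, hσ⟩ := hφ.foliations
  obtain ⟨i, rfl⟩ := σ.surjective j
  have key : ∀ Z : VField n M', (∀ y, W'.form (σ i) y (Z y) = 0) →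
      ∀ y, W.form i y (VectorField.mpullback 𝓘(ℝ, Model n) 𝓘(ℝ, Model n) φ Z y) = 0 := by
    intro Z hZ y
    obtain ⟨c, hc, h⟩ := hσ i y
    have h1 := congrArg
      (fun η : TangentSpace 𝓘(ℝ, Model n) y →L[ℝ] ℝ =>
        η (VectorField.mpullback 𝓘(ℝ, Model n) 𝓘(ℝ, Model n) φ Z y)) h
    simp only [pullback, ContinuousLinearMap.comp_apply, mfderiv_mpullback (hinv y), hZ,
      _root_.smul_apply, smul_eq_mul] at h1
    exact (mul_eq_zero.1 h1.symm).resolve_left hc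
  have h1 := hg i _ _ (hX.mpullback hφ.smooth hinv) (hY.mpullback hφ.smooth hinv) (key X hjX)
    (key Y hjY) x
  obtain ⟨c, -, h⟩ := hσ i x
  have h2 := congrArg (fun η : TangentSpace 𝓘(ℝ, Model n) x →L[ℝ] ℝ =>
      η (nabla (VectorField.mpullback 𝓘(ℝ, Model n) 𝓘(ℝ, Model n) φ Y) x
        (VectorField.mpullback 𝓘(ℝ, Model n) 𝓘(ℝ, Model n) φ X x))) h
  simp only [pullback, ContinuousLinearMap.comp_apply, _root_.smul_apply, h1, smul_zero] at h2
  rw [secondFundamentalForm, map_sub, h2, hg' (σ i) X Y hX hY hjX hjY, sub_zero]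

/-- If `f` and `f'` give the distinguished foliations near `x` and `φ x`, then `φ^*(df') = a df` near
`x`, and the symmetric parts of `∇ df` and `∇' df'` vanish. Hence `df'` kills the symmetric part of
the second fundamental form, which is all of it. -/
theorem form_idx_secondFundamentalForm_eq_zero {W : PointedWeb n d M}
    {W' : PointedWeb n d M'} (h : W.IsCanonical nabla) (h' : W'.IsCanonical nabla')
    (hφ : IsPointedWebMap W W' φ)
    (hinv : ∀ x, (mfderiv 𝓘(ℝ, Model n) 𝓘(ℝ, Model n) φ x).IsInvertible)
    {X Y : VField n M'} (hX : SmoothField X) (hY : SmoothField Y) (x : M) :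
    W'.form W'.idx (φ x) (secondFundamentalForm nabla nabla' φ x X Y) = 0 := by
  obtain ⟨a, b, -, hab⟩ := hφ.functions x
  set f := W.fn x with hf
  set f' := W'.fn (φ x) with hf'
  have hU := (W.isOpen_dom x).mem_nhds (W.mem_dom x)
  have hU' := (W'.isOpen_dom (φ x)).mem_nhds (W'.mem_dom (φ x))
  have hφd := hφ.smooth.mdifferentiable (by simp)
  have hd : ∀ᶠ y in 𝓝 x,
      pullback (n := n) φ (differential f') y = a • differential f y := by
    filter_upwards [hab.eventually_nhds, hU, hφd.continuous.continuousAt.preimage_mem_nhds hU']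
      with y hy hyU hyU'
    have hf'y : MDifferentiableAt 𝓘(ℝ, Model n) 𝓘(ℝ) f' (φ y) :=
      ((W'.smooth_fn (φ x)).contMDiffAt ((W'.isOpen_dom _).mem_nhds hyU')).mdifferentiableAt
        (by simp)
    have hfy : MDifferentiableAt 𝓘(ℝ, Model n) 𝓘(ℝ) f y :=
      ((W.smooth_fn x).contMDiffAt ((W.isOpen_dom _).mem_nhds hyU)).mdifferentiableAt (by simp)
    have hgauge : differential (n := n) (f' ∘ φ) y
        = differential (n := n) ((fun _ : M => a) * f + fun _ => b) y := by
      exact differential_congr hy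
    have hchain : differential (f' ∘ φ) y = pullback φ (differential f') y :=
      mvfderiv_comp y hf'y (hφd y)
    rw [← hchain, hgauge]
    have hmul : MDifferentiableAt 𝓘(ℝ, Model n) 𝓘(ℝ) ((fun _ : M => a) * f) y :=
      mdifferentiableAt_const.mul hfy
    simp only [differential]
    rw [mvfderiv_add hmul mdifferentiableAt_const, mvfderiv_mul mdifferentiableAt_const hfy,
      mvfderiv_const, mvfderiv_const]
    simp
  have hcov : ∀ Z T : VField n M, SmoothField T →
      covDiff nabla (pullback φ (differential f')) Z T x
        = a * covDiff nabla (differential f) Z T x := by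
    intro Z T hT
    have hfT : MDifferentiableAt 𝓘(ℝ, Model n) 𝓘(ℝ) (fun y => differential f y (T y)) x :=
      mdifferentiableAt_differential_apply (W.isOpen_dom x) (W.smooth_fn x) (W.mem_dom x) hT
    have h1 : differential (n := n) (fun y => pullback φ (differential f') y (T y)) x
        = differential (n := n) ((fun _ : M => a) * fun y => differential f y (T y)) x :=
      differential_congr (hd.mono fun y hy =>
        congrArg (fun θ : TangentSpace 𝓘(ℝ, Model n) y →L[ℝ] ℝ => θ (T y)) hy)
    have h2 : differential (n := n) ((fun _ : M => a) * fun y => differential f y (T y)) x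
        = a • differential (n := n) (fun y => differential f y (T y)) x := by
      simp only [differential] at hfT ⊢
      rw [mvfderiv_mul mdifferentiableAt_const hfT, mvfderiv_const]
      simp
    simp only [covDiff, h1, h2, hd.self_of_nhds, _root_.smul_apply, smul_eq_mul]
    ring
  have hsub : ∀ Z T : VField n M', SmoothField T →
      a * covDiff nabla (differential f) (VectorField.mpullback 𝓘(ℝ, Model n) 𝓘(ℝ, Model n) φ Z)
          (VectorField.mpullback 𝓘(ℝ, Model n) 𝓘(ℝ, Model n) φ T) x
        - covDiff nabla' (differential f') Z T (φ x)
        = -differential f' (φ x) (secondFundamentalForm nabla nabla' φ x Z T) := by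
    intro Z T hT
    rw [← hcov _ _ (hT.mpullback hφ.smooth hinv)]
    exact covDiff_pullback_sub_covDiff nabla nabla' hφ.smooth hinv
      (mdifferentiableAt_differential_apply (W'.isOpen_dom _) (W'.smooth_fn _) (W'.mem_dom _) hT)
  have hXY := hsub X Y hY
  have hYX := hsub Y X hX
  rw [← secondFundamentalForm_symm h.torsionFree h'.torsionFree hφ.smooth hinv x hX hY] at hYX
  have hs := h.affine x _ _ (hX.mpullback hφ.smooth hinv) (hY.mpullback hφ.smooth hinv) x
    (W.mem_dom x)
  have hs' := h'.affine (φ x) X Y hX hY (φ x) (W'.mem_dom _)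
  simp only [symCovDiff, ← hf, ← hf'] at hs hs'
  have hzero : differential f' (φ x) (secondFundamentalForm nabla nabla' φ x X Y) = 0 := by
    linear_combination (1 / 2) * hXY + (1 / 2) * hYX - a * hs + hs'
  obtain ⟨s, hs0, hs⟩ := W'.differential_fn (φ x) (φ x) (W'.mem_dom _)
  rw [hs, _root_.smul_apply, smul_eq_mul] at hzero
  exact (mul_eq_zero.1 hzero).resolve_left hs0

theorem secondFundamentalForm_eq_zero [T2Space M'] (hd : n + 2 ≤ d) {W : PointedWeb n d M}
    {W' : PointedWeb n d M'} (h : W.IsCanonical nabla) (h' : W'.IsCanonical nabla')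
    (hφ : IsPointedWebMap W W' φ)
    (hinv : ∀ x, (mfderiv 𝓘(ℝ, Model n) 𝓘(ℝ, Model n) φ x).IsInvertible) (x : M)
    {X Y : VField n M'} (hX : SmoothField X) (hY : SmoothField Y) :
    secondFundamentalForm nabla nabla' φ x X Y = 0 := by
  obtain ⟨B, hB⟩ := exists_bilinear_eq_secondFundamentalForm nabla nabla' hφ.smooth hinv x
  rw [← hB X Y hX hY]
  -- On a `0`-manifold the forms of a web may vanish, but so do all tangent vectors.
  rcases Nat.eq_zero_or_pos n with rfl | hn
  · exact W'.eq_zero_of_form_eq_zero (s := ∅) rfl (by simp)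
  have hfr : Module.finrank ℝ (TangentSpace 𝓘(ℝ, Model n) (φ x)) = n :=
    finrank_euclideanSpace_fin
  let B' : TangentSpace 𝓘(ℝ, Model n) (φ x) →ₗ[ℝ] TangentSpace 𝓘(ℝ, Model n) (φ x) →ₗ[ℝ]
      TangentSpace 𝓘(ℝ, Model n) (φ x) :=
    LinearMap.mk₂ ℝ (fun v w => B v w) (by simp) (by simp) (by simp) (by simp)
  have hfd : FiniteDimensional ℝ (TangentSpace 𝓘(ℝ, Model n) (φ x)) :=
    inferInstanceAs (FiniteDimensional ℝ (Model n))
  have hB' : B' = 0 := by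
    refine bilinear_eq_zero_of_preserves_kernels (ι := Fin d) (by rw [hfr]; simpa using hd)
      (fun i => (W'.form i (φ x)).toLinearMap)
      (fun s hs v hv => W'.eq_zero_of_form_eq_zero (hs.trans hfr) hv) B' ?_ ?_ W'.idx ?_
    · intro v w
      obtain ⟨X, hX, rfl⟩ := exists_smoothField_eq (φ x) v
      obtain ⟨Y, hY, rfl⟩ := exists_smoothField_eq (φ x) w
      change B _ _ = B _ _
      rw [hB _ _ hX hY, hB _ _ hY hX]
      exact secondFundamentalForm_symm h.torsionFree h'.torsionFree hφ.smooth hinv x hX hY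
    · intro i v w hv hw
      have hi := W'.form_ne_zero hn (by omega) i (φ x)
      obtain ⟨X, hX, hX0, rfl⟩ := exists_smoothField_eq_of_apply_eq_zero (W'.smooth i) hi hv
      obtain ⟨Y, hY, hY0, rfl⟩ := exists_smoothField_eq_of_apply_eq_zero (W'.smooth i) hi hw
      change W'.form i (φ x) (B _ _) = 0
      rw [hB _ _ hX hY]
      exact form_secondFundamentalForm_eq_zero_of_tangent h.geodesic h'.geodesic hφ hinv hX hY i
        hX0 hY0 x
    · intro v w
      obtain ⟨X, hX, rfl⟩ := exists_smoothField_eq (φ x) v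
      obtain ⟨Y, hY, rfl⟩ := exists_smoothField_eq (φ x) w
      change W'.form W'.idx (φ x) (B _ _) = 0
      rw [hB _ _ hX hY]
      exact form_idx_secondFundamentalForm_eq_zero h h' hφ hinv hX hY x
  exact congrArg (fun C => C (X (φ x)) (Y (φ x))) hB'

end WebMaps

end GeodesicWeb

theorem theorem8 {n d : ℕ} (hd : n + 2 ≤ d)
    {M : Type*} [TopologicalSpace M] [T2Space M]
    [ChartedSpace (GeodesicWeb.Model n) M] [IsManifold 𝓘(ℝ, GeodesicWeb.Model n) ∞ M]
    {M' : Type*} [TopologicalSpace M'] [T2Space M']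
    [ChartedSpace (GeodesicWeb.Model n) M'] [IsManifold 𝓘(ℝ, GeodesicWeb.Model n) ∞ M']
    (W : GeodesicWeb.PointedWeb n d M) (W' : GeodesicWeb.PointedWeb n d M')
    (nabla : GeodesicWeb.Connection n M) (nabla' : GeodesicWeb.Connection n M')
    (h : W.IsCanonical nabla) (h' : W'.IsCanonical nabla')
    (φ : M → M') (hφ : GeodesicWeb.IsPointedWebMap W W' φ) :
    GeodesicWeb.IsAffineMap nabla nabla' φ := by
  open GeodesicWeb in
  intro η hη X Y _ hY X' Y' hX' hY' x hXX' hYY'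
  have hinv := hφ.isInvertible_mfderiv (by omega)
  have hX'x : X x = VectorField.mpullback 𝓘(ℝ, Model n) 𝓘(ℝ, Model n) φ X' x := by
    rw [VectorField.mpullback_apply, ← hXX', (hinv x).inverse_apply_self]
  have hY'x : Y x = VectorField.mpullback 𝓘(ℝ, Model n) 𝓘(ℝ, Model n) φ Y' x := by
    rw [VectorField.mpullback_apply, ← hYY', (hinv x).inverse_apply_self]
  -- By tensoriality, `X` and `Y` may be replaced by the pull-backs of `X'` and `Y'`.
  rw [covDiff_congr nabla (fun Z hZ => hη.mdifferentiableAt_pullback_apply hφ.smooth hZ)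
    (hY.mdifferentiableAt x) ((hY'.mpullback hφ.smooth hinv).mdifferentiableAt x) hX'x hY'x,
    ← sub_eq_zero, covDiff_pullback_sub_covDiff nabla nabla' hφ.smooth hinv
      ((hη.contMDiff_apply hY').mdifferentiable (by simp) _),
    secondFundamentalForm_eq_zero hd h h' hφ hinv x hX' hY', map_zero, neg_zero]
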